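/- Let $\mathcal H$ be a complex Hilbert space, with inner product antilinear in the first argument, and let $A\in\mathrm{Sym}^{(1,1)}_{\mathrm R}(\mathcal H)$, i.e. let $A$ be a closed, densely defined, symmetric operator on $\mathcal H$ with deficiency indices $(1,1)$ that is simple (there is no nonzero closed subspace on which $A$ induces a selfadjoint operator) and regular (for every $z\in\mathbb C$ there is $c_z>0$ with $\|(A-zI)\varphi\|\ge c_z\|\varphi\|$ for all $\varphi\in\operatorname{dom}(A)$). A vector $\mu\in\mathcal H$ is a gauge for $A$ if $\mathcal H=\operatorname{ran}(A-zI)\dotplus\operatorname{span}\{\mu\}$ for some $z\in\mathbb C$, and $A$ is called entire if there is a gauge $\mu$ for which this direct sum decomposition holds for all $z\in\mathbb C$. Let $A_\gamma$ be any selfadjoint extension of $A$, let $g$ be any entire function with $\overline{g(\bar z)}=g(z)$ whose zeros are simple and whose set of zeros is the spectrum $\operatorname{Sp}(A_\gamma)$, let $z_0\in\mathbb C\setminus\operatorname{Sp}(A_\gamma)$ and $0\ne\psi_0\in\operatorname{Ker}(A^*-z_0I)$. Put $$\xi(z)=g(z)\,(A_\gamma-z_0I)(A_\gamma-zI)^{-1}\psi_0,\qquad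 z\in\mathbb C\setminus\operatorname{Sp}(A_\gamma),$$ extended by its limits to the points of $\operatorname{Sp}(A_\gamma)$, and let the de Branges representation space of $A$ be $$\widehat{\mathcal H}=\bigl\{\,z\mapsto\langle\xi(\bar z),\varphi\rangle \;:\; \varphi\in\mathcal H\,\bigr\}.$$ Then $A$ is entire if and only if $\widehat{\mathcal H}$ contains a real zero-free entire function, that is, an entire function $f$ with $\overline{f(\bar z)}=f(z)$ and $f(z)\neq0$ for all $z\in\mathbb C$. -/

import Mathlib

open scoped ComplexConjugate Topology
open LinearPMap

noncomputable section

namespace EntireOperators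

variable {H : Type*} [NormedAddCommGroup H] [InnerProductSpace ℂ H]

/-! ## Unbounded operators -/

/-- The linear map `T - z I` on the domain of `T`. -/
def shift (T : H →ₗ.[ℂ] H) (z : ℂ) : T.domain →ₗ[ℂ] H :=
  T.toFun - z • T.domain.subtype

/-- `ran (T - z I)`. -/
def ranShift (T : H →ₗ.[ℂ] H) (z : ℂ) : Submodule ℂ H :=
  LinearMap.range (shift T z)

/-- `Ker (T - z I)`, as a subspace of the whole space. -/
def kerShift (T : H →ₗ.[ℂ] H) (z : ℂ) : Submodule ℂ H :=
  (LinearMap.ker (shift T z)).map T.domain.subtype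

/-- `R` is a bounded two-sided inverse of `T - z I`. -/
def IsResolventAt (T : H →ₗ.[ℂ] H) (z : ℂ) (R : H →L[ℂ] H) : Prop :=
  (∀ y : H, ∃ h : R y ∈ T.domain, shift T z ⟨R y, h⟩ = y) ∧
    ∀ x : T.domain, R (shift T z x) = x

/-- The resolvent set of an unbounded operator. -/
def resolventSet (T : H →ₗ.[ℂ] H) : Set ℂ :=
  {z | ∃ R : H →L[ℂ] H, IsResolventAt T z R}

/-- The spectrum of an unbounded operator. -/
def spectrum (T : H →ₗ.[ℂ] H) : Set ℂ := (resolventSet T)ᶜ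

/-- The resolvent `(T - z I)⁻¹` at a point of the resolvent set (the operator is unique). -/
def resolvent (T : H →ₗ.[ℂ] H) (z : ℂ) (hz : z ∈ resolventSet T) : H →L[ℂ] H :=
  hz.choose

theorem resolvent_spec (T : H →ₗ.[ℂ] H) (z : ℂ) (hz : z ∈ resolventSet T) :
    IsResolventAt T z (resolvent T z hz) :=
  hz.choose_spec

theorem resolvent_mem_domain (T : H →ₗ.[ℂ] H) (z : ℂ) (hz : z ∈ resolventSet T) (y : H) :
    resolvent T z hz y ∈ T.domain :=
  ((resolvent_spec T z hz).1 y).1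

/-! ## The class of operators -/

/-- `A` is regular: every complex number is a point of regular type of `A`. -/
def IsRegular (A : H →ₗ.[ℂ] H) : Prop :=
  ∀ z : ℂ, ∃ c : ℝ, 0 < c ∧ ∀ x : A.domain, c * ‖(x : H)‖ ≤ ‖shift A z x‖

/-- `A` is simple (completely non-selfadjoint): there is no nonzero closed subspace `K` on which
`A` induces a selfadjoint operator, i.e. no selfadjoint operator `B` in a nonzero closed subspace
`K` is a restriction of `A`. (If `A` is symmetric and `B` is such an operator, then `K`
automatically reduces `A`, and `B` is the part of `A` in `K`.) -/
def IsSimple [CompleteSpace H] (A : H →ₗ.[ℂ] H) : Prop :=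
  ∀ (K : Submodule ℂ H) [CompleteSpace K] (B : K →ₗ.[ℂ] K), IsSelfAdjoint B →
    (∀ x : B.domain, ∃ h : ((x : K) : H) ∈ A.domain, A ⟨((x : K) : H), h⟩ = (B x : H)) →
    K = ⊥

/-- The class of simple, regular, closed symmetric operators, densely defined on `H`, whose
deficiency indices are `(1,1)`. -/
structure MemSymR11 [CompleteSpace H] (A : H →ₗ.[ℂ] H) : Prop where
  dense_domain : Dense (A.domain : Set H)
  symmetric : ∀ x y : A.domain, inner ℂ (A x) (y : H) = inner ℂ (x : H) (A y)
  closed : A.IsClosed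
  regular : IsRegular A
  simple : IsSimple A
  deficiency_pos : Module.finrank ℂ (kerShift A† Complex.I) = 1
  deficiency_neg : Module.finrank ℂ (kerShift A† (-Complex.I)) = 1

/-- `B` is a selfadjoint extension of `A`. -/
def IsSelfAdjointExtension [CompleteSpace H] (A B : H →ₗ.[ℂ] H) : Prop :=
  A ≤ B ∧ IsSelfAdjoint B

/-! ## Gauges and entire operators -/

/-- `H` is the direct sum of `ran (A - z I)` and `span {μ}`. -/
def DirectSumAt (A : H →ₗ.[ℂ] H) (μ : H) (z : ℂ) : Prop :=
  IsCompl (ranShift A z) (Submodule.span ℂ {μ})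

/-- `μ` is a gauge for `A`. -/
def IsGauge (A : H →ₗ.[ℂ] H) (μ : H) : Prop := ∃ z₀ : ℂ, DirectSumAt A μ z₀

/-- The exceptional set `S_μ`. -/
def exceptionalSet (A : H →ₗ.[ℂ] H) (μ : H) : Set ℂ := {z | DirectSumAt A μ z}ᶜ

/-- `A` is entire: it has a gauge with empty exceptional set. -/
def IsEntireOperator (A : H →ₗ.[ℂ] H) : Prop :=
  ∃ μ : H, IsGauge A μ ∧ exceptionalSet A μ = ∅

/-! ## The de Branges representation space -/

/-- A real entire function: `f` is entire and `f^# = f`, where `f^#(z)` is the complex conjugate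
of `f` at the conjugate of `z`. -/
def IsRealEntire (f : ℂ → ℂ) : Prop :=
  Differentiable ℂ f ∧ ∀ z : ℂ, conj (f (conj z)) = f z

/-- The generalized Cayley transform `ψ(z) = (T - z₀ I) (T - z I)⁻¹ ψ₀` for `z` outside the
spectrum of `T` (and the default value `0` on the spectrum). -/
def cayley (T : H →ₗ.[ℂ] H) (z₀ : ℂ) (ψ₀ : H) (z : ℂ) : H :=
  open scoped Classical in
  if hz : z ∈ resolventSet T then
    shift T z₀ ⟨resolvent T z hz ψ₀, resolvent_mem_domain T z hz ψ₀⟩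
  else 0

/-- The function `ξ(z) = g(z) ψ(z)`, extended to the points of the spectrum of `T` (where `ψ` has
poles and `g` has zeros) by its limits there. -/
def xi (T : H →ₗ.[ℂ] H) (g : ℂ → ℂ) (z₀ : ℂ) (ψ₀ : H) (z : ℂ) : H :=
  open scoped Classical in
  if z ∈ resolventSet T then g z • cayley T z₀ ψ₀ z
  else Filter.limUnder (𝓝[≠] z) (fun w => g w • cayley T z₀ ψ₀ w)

/-- The map `(Φ φ)(z) = ⟪ξ(z̄), φ⟫`, the inner product being antilinear in the first argument. -/
def repMap (ξ : ℂ → H) : H →ₗ[ℂ] (ℂ → ℂ) where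
  toFun φ := fun z => inner ℂ (ξ (conj z)) φ
  map_add' φ η := by
    funext z
    exact inner_add_right _ _ _
  map_smul' c φ := by
    funext z
    exact inner_smul_right _ _ _

/-- The representation space `Ĥ = Φ H` (as a linear space of functions), built from the
selfadjoint extension `T`, the function `g` and the vector `ψ₀`. -/
def repSpace (T : H →ₗ.[ℂ] H) (g : ℂ → ℂ) (z₀ : ℂ) (ψ₀ : H) : Submodule ℂ (ℂ → ℂ) :=
  LinearMap.range (repMap (xi T g z₀ ψ₀))

end EntireOperators

end

/-!
With `Φ μ = (z ↦ ⟪ξ(z̄), μ⟫)`, the theorem rests on the fact that `ξ(z)` is, for every `z`, a nonzero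
vector spanning `ran (A - z̄ I)ᗮ` (`xi_ne_zero_and_mem_ranShift_iff`). Hence `H` is the direct sum of
`ran (A - z I)` and `span {μ}` exactly when `(Φ μ)(z) ≠ 0`, and `A` is entire iff some `Φ μ` has no
zeros. On the resolvent set of the selfadjoint extension `T` the fact follows by transporting the
deficiency space with the generalized Cayley transform `ψ(z) = ψ₀ + (z - z₀) (T - z I)⁻¹ ψ₀`. At a
point `λ` of the spectrum, regularity of `A` makes `λ` an eigenvalue of `T`, with unit eigenvector
`e` spanning `ran (A - λ I)ᗮ`, and the simple zero of `g` cancels the pole of the resolvent: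
`ξ(λ) = -g'(λ) (λ - z₀) ⟪e, ψ₀⟫ e`.

It remains to pass from a zero-free `f = Φ μ` to a real zero-free element of the representation
space. The geometric mean `F = (f f^#)^{1/2}`, where `f^#(z)` is the conjugate of `f(z̄)`, is real,
entire and zero-free, and it belongs to the representation space (`mem_repSpace_of_norm_sq_le`): on
the (real) spectrum `|F| = |f|`, and the vectors `ξ(λ)` are orthogonal, so Bessel's inequality gives
`φ` with `Φ φ = F` on the spectrum, whence `F - Φ φ = g q` with `q` entire. Both `F / g` and
`Φ φ / g` are dominated by `‖ψ(z)‖ + ‖ψ(z̄)‖`, which is `O((1 + |z|) / |Im z|)` and tends to `0`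
along the imaginary axis. The first bound makes `q` constant by a Liouville argument
(`eq_const_of_abs_im_mul_norm_le`), the second makes it zero.
-/

noncomputable section

namespace EntireOperators

variable {H : Type*} [NormedAddCommGroup H] [InnerProductSpace ℂ H]

/-! ### Ranges of closed and selfadjoint operators -/

theorem shift_apply (T : H →ₗ.[ℂ] H) (z : ℂ) (x : T.domain) :
    shift T z x = T x - z • (x : H) := rfl

theorem shift_eq_shift_add (T : H →ₗ.[ℂ] H) (z w : ℂ) (x : T.domain) :
    shift T w x = shift T z x + (z - w) • (x : H) := by
  simp only [shift_apply, sub_smul]; abel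

theorem shift_eq_of_le {A T : H →ₗ.[ℂ] H} (hAT : A ≤ T) (z : ℂ) (x : A.domain) :
    shift T z ⟨x, hAT.1 x.2⟩ = shift A z x := by
  have h : A x = T ⟨x, hAT.1 x.2⟩ := hAT.2 rfl
  rw [shift_apply, shift_apply, h]

theorem ranShift_mono {A T : H →ₗ.[ℂ] H} (hAT : A ≤ T) (z : ℂ) : ranShift A z ≤ ranShift T z := by
  rintro _ ⟨x, rfl⟩
  exact ⟨⟨x, hAT.1 x.2⟩, shift_eq_of_le hAT z x⟩

/-- A closed operator that is bounded below has closed range. -/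
theorem isClosed_ranShift [CompleteSpace H] {B : H →ₗ.[ℂ] H} (hB : B.IsClosed) {z : ℂ} {c : ℝ}
    (hc : 0 < c) (hbd : ∀ x : B.domain, c * ‖(x : H)‖ ≤ ‖shift B z x‖) :
    IsClosed (ranShift B z : Set H) := by
  apply IsSeqClosed.isClosed
  intro u y hu hy
  choose x hx using hu
  have hx' : ∀ n, shift B z (x n) = u n := hx
  have hcau : CauchySeq fun n => (x n : H) := by
    rw [Metric.cauchySeq_iff]
    intro ε hε
    obtain ⟨N, hN⟩ := Metric.cauchySeq_iff.1 hy.cauchySeq (c * ε) (by positivity)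
    refine ⟨N, fun m hm n hn => ?_⟩
    have h1 := hbd (x m - x n)
    rw [_root_.map_sub, hx', hx', ← dist_eq_norm] at h1
    have h2 := hN m hm n hn
    rw [dist_eq_norm]
    have h3 : c * ‖(x m : H) - x n‖ < c * ε := lt_of_le_of_lt h1 h2
    exact lt_of_mul_lt_mul_left h3 hc.le
  obtain ⟨x₀, hx₀⟩ := cauchySeq_tendsto_of_complete hcau
  have hlim : Filter.Tendsto (fun n => ((x n : H), B (x n))) Filter.atTop
      (𝓝 (x₀, y + z • x₀)) := by
    refine hx₀.prodMk_nhds ?_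
    have : (fun n => B (x n)) = fun n => u n + z • (x n : H) := by
      funext n
      rw [← hx' n, shift_apply]; abel
    rw [this]
    exact hy.add (hx₀.const_smul z)
  have hmem : (x₀, y + z • x₀) ∈ B.graph :=
    IsClosed.mem_of_tendsto hB hlim (Filter.Eventually.of_forall fun n => B.mem_graph (x n))
  obtain ⟨x', hx1, hx2⟩ := (LinearPMap.mem_graph_iff B).1 hmem
  refine ⟨x', ?_⟩
  rw [shift_apply, hx2, hx1]
  simp

theorem inner_of_isSelfAdjoint [CompleteSpace H] {T : H →ₗ.[ℂ] H} (hT : IsSelfAdjoint T)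
    (x y : T.domain) : inner ℂ (T x) (y : H) = inner ℂ (x : H) (T y) := by
  have h := LinearPMap.adjoint_isFormalAdjoint hT.dense_domain
  rw [isSelfAdjoint_def.1 hT] at h
  exact h x y

/-- `⟪(T - z) x, y⟫ = ⟪x, (T - z̄) y⟫` for selfadjoint `T`. -/
theorem inner_shift_left [CompleteSpace H] {T : H →ₗ.[ℂ] H} (hT : IsSelfAdjoint T)
    (z : ℂ) (x y : T.domain) :
    inner ℂ (shift T z x) (y : H) = inner ℂ (x : H) (shift T (conj z) y) := by
  simp only [shift_apply, inner_sub_left, inner_sub_right, inner_smul_left, inner_smul_right,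
    inner_of_isSelfAdjoint hT]

/-- `Ker (A* - z I)` is the orthogonal complement of `ran (A - z̄ I)`. -/
theorem mem_kerShift_adjoint_iff [CompleteSpace H] {A : H →ₗ.[ℂ] H}
    (hA : Dense (A.domain : Set H)) {z : ℂ} {y : H} :
    y ∈ kerShift A† z ↔ ∀ x : A.domain, inner ℂ y (shift A (conj z) x) = 0 := by
  constructor
  · rintro ⟨y', hy', rfl⟩ x
    have h1 : A† y' - z • (y' : H) = 0 := hy'
    have h2 := LinearPMap.adjoint_isFormalAdjoint hA y' x
    rw [sub_eq_zero.1 h1, inner_smul_left] at h2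
    simp only [shift_apply, inner_sub_right, inner_smul_right, Submodule.subtype_apply]
    rw [← h2, sub_self]
  · intro h
    have h' : ∀ x : A.domain, inner ℂ (z • y) (x : H) = inner ℂ y (A x) := by
      intro x
      have := h x
      rw [shift_apply, inner_sub_right, inner_smul_right, sub_eq_zero] at this
      rw [inner_smul_left, this]
    have hy := LinearPMap.mem_adjoint_domain_of_exists y ⟨_, h'⟩
    refine ⟨⟨y, hy⟩, ?_, rfl⟩
    change A† ⟨y, hy⟩ - z • y = 0
    rw [LinearPMap.adjoint_apply_eq hA ⟨y, hy⟩ h', sub_self]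

/-- A vector orthogonal to `ran (T - z̄ I)`, for selfadjoint `T`, lies in `Ker (T - z I)`. -/
theorem exists_shift_eq_zero [CompleteSpace H] {T : H →ₗ.[ℂ] H} (hT : IsSelfAdjoint T)
    {z : ℂ} {y : H} (hy : ∀ x : T.domain, inner ℂ y (shift T (conj z) x) = 0) :
    ∃ h : y ∈ T.domain, shift T z ⟨y, h⟩ = 0 := by
  have h := (mem_kerShift_adjoint_iff hT.dense_domain).2 hy
  rw [isSelfAdjoint_def.1 hT] at h
  obtain ⟨y', hy', rfl⟩ := h
  exact ⟨y'.2, hy'⟩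

theorem abs_im_mul_norm_le [CompleteSpace H] {T : H →ₗ.[ℂ] H} (hT : IsSelfAdjoint T)
    (z : ℂ) (x : T.domain) : |z.im| * ‖(x : H)‖ ≤ ‖shift T z x‖ := by
  have h1 : (inner ℂ (x : H) (shift T z x)).im = -(z.im * ‖(x : H)‖ ^ 2) := by
    have h2 : (inner ℂ (x : H) (T x) : ℂ).im = 0 := by
      have := inner_of_isSelfAdjoint hT x x
      rw [← inner_conj_symm] at this
      exact Complex.conj_eq_iff_im.1 this
    rw [shift_apply, inner_sub_right, inner_smul_right, inner_self_eq_norm_sq_to_K]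
    simp only [Complex.sub_im, h2, Complex.coe_algebraMap, ← Complex.ofReal_pow,
      Complex.im_mul_ofReal, zero_sub]
  have h2 : |z.im| * ‖(x : H)‖ ^ 2 ≤ ‖(x : H)‖ * ‖shift T z x‖ := by
    calc |z.im| * ‖(x : H)‖ ^ 2 = |(inner ℂ (x : H) (shift T z x)).im| := by
          rw [h1, abs_neg, abs_mul, abs_of_nonneg (sq_nonneg ‖(x : H)‖)]
      _ ≤ ‖inner ℂ (x : H) (shift T z x)‖ := Complex.abs_im_le_norm _
      _ ≤ _ := norm_inner_le_norm _ _
  rcases eq_or_lt_of_le (norm_nonneg (x : H)) with h0 | h0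
  · rw [← h0]; simp
  · refine le_of_mul_le_mul_left ?_ h0
    calc _ = |z.im| * ‖(x : H)‖ ^ 2 := by ring
      _ ≤ _ := h2

/-- For a closed operator, bijectivity of `T - z I` suffices for `z` to be in the resolvent set:
the inverse is bounded by the closed graph theorem. -/
theorem mem_resolventSet_of_bijective [CompleteSpace H] {T : H →ₗ.[ℂ] H} (hT : T.IsClosed)
    {z : ℂ} (hinj : ∀ x : T.domain, shift T z x = 0 → x = 0)
    (hsurj : ∀ y, y ∈ ranShift T z) : z ∈ resolventSet T := by
  have hbij : Function.Bijective (shift T z) :=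
    ⟨(injective_iff_map_eq_zero _).2 hinj, hsurj⟩
  let e := LinearEquiv.ofBijective (shift T z) hbij
  let S : H →ₗ[ℂ] H := T.domain.subtype ∘ₗ e.symm.toLinearMap
  have he : ∀ y, shift T z (e.symm y) = y := fun y => e.apply_symm_apply y
  have hS : Continuous S := by
    refine S.continuous_of_seq_closed_graph fun u x y hu hSu => ?_
    have hlim : Filter.Tendsto (fun n => ((e.symm (u n) : H), T (e.symm (u n)))) Filter.atTop
        (𝓝 (y, x + z • y)) := by
      refine Filter.Tendsto.prodMk_nhds hSu ?_
      have : (fun n => T (e.symm (u n))) = fun n => u n + z • (e.symm (u n) : H) := by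
        funext n
        rw [← sub_eq_iff_eq_add, ← shift_apply, he]
      rw [this]
      exact hu.add (hSu.const_smul z)
    have hmem : (y, x + z • y) ∈ T.graph :=
      IsClosed.mem_of_tendsto hT hlim (Filter.Eventually.of_forall fun n => T.mem_graph _)
    obtain ⟨y', hy1, hy2⟩ := (LinearPMap.mem_graph_iff T).1 hmem
    have : shift T z y' = x := by
      rw [shift_apply, hy2, hy1]; simp
    have h3 : e.symm x = y' := by
      rw [LinearEquiv.symm_apply_eq]; exact this.symm
    change y = (e.symm x : H)
    rw [h3]; exact hy1.symm
  refine ⟨⟨S, hS⟩, fun y => ⟨(e.symm y).2, he y⟩, fun x => ?_⟩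
  change ((e.symm (shift T z x) : T.domain) : H) = x
  rw [show shift T z x = e x from rfl, e.symm_apply_apply]

theorem eq_zero_of_shift_eq_zero {T : H →ₗ.[ℂ] H} {z : ℂ} (hz : z ∈ resolventSet T)
    {x : T.domain} (hx : shift T z x = 0) : x = 0 := by
  have h := (resolvent_spec T z hz).2 x
  rw [hx, _root_.map_zero] at h
  exact Subtype.ext h.symm

/-- For selfadjoint `T`, a point `z` is in the resolvent set if `T - z I` has closed range and
neither `z` nor `z̄` is an eigenvalue. -/
theorem mem_resolventSet_of_isClosed [CompleteSpace H] {T : H →ₗ.[ℂ] H} (hT : IsSelfAdjoint T)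
    {z : ℂ} (hcl : IsClosed (ranShift T z : Set H))
    (hinj : ∀ x : T.domain, shift T z x = 0 → x = 0)
    (hinj' : ∀ x : T.domain, shift T (conj z) x = 0 → x = 0) : z ∈ resolventSet T := by
  refine mem_resolventSet_of_bijective hT.isClosed hinj ?_
  have : CompleteSpace (ranShift T z) := hcl.completeSpace_coe
  have htop : ranShift T z = ⊤ := by
    rw [← Submodule.orthogonal_eq_bot_iff, Submodule.eq_bot_iff]
    intro y hy
    have hy' : ∀ x : T.domain, inner ℂ y (shift T (conj (conj z)) x) = 0 := by
      intro x
      rw [Complex.conj_conj]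
      exact (Submodule.mem_orthogonal' _ _).1 hy _ ⟨x, rfl⟩
    obtain ⟨h, h0⟩ := exists_shift_eq_zero hT hy'
    exact congrArg Subtype.val (hinj' _ h0)
  intro y
  rw [htop]
  trivial

theorem mem_resolventSet_of_im_ne_zero [CompleteSpace H] {T : H →ₗ.[ℂ] H} (hT : IsSelfAdjoint T)
    {z : ℂ} (hz : z.im ≠ 0) : z ∈ resolventSet T := by
  have hinj : ∀ w : ℂ, w.im ≠ 0 → ∀ x : T.domain, shift T w x = 0 → x = 0 := by
    intro w hw x hx
    have h := abs_im_mul_norm_le hT w x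
    rw [hx, norm_zero] at h
    have h2 : ‖(x : H)‖ ≤ 0 := by
      by_contra hcon
      have := mul_pos (abs_pos.2 hw) (not_le.1 hcon)
      linarith
    exact Subtype.ext (norm_le_zero_iff.1 h2)
  exact mem_resolventSet_of_isClosed hT
    (isClosed_ranShift hT.isClosed (abs_pos.2 hz) (abs_im_mul_norm_le hT z))
    (hinj z hz) (hinj _ (by simpa using hz))

theorem conj_eq_of_notMem_resolventSet [CompleteSpace H] {T : H →ₗ.[ℂ] H} (hT : IsSelfAdjoint T)
    {z : ℂ} (hz : z ∉ resolventSet T) : conj z = z := by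
  by_contra h
  exact hz (mem_resolventSet_of_im_ne_zero hT fun h0 => h (Complex.conj_eq_iff_im.2 h0))

theorem conj_mem_resolventSet [CompleteSpace H] {T : H →ₗ.[ℂ] H} (hT : IsSelfAdjoint T)
    {z : ℂ} (hz : z ∈ resolventSet T) : conj z ∈ resolventSet T := by
  by_contra h
  have := conj_eq_of_notMem_resolventSet hT h
  rw [Complex.conj_conj] at this
  exact h (this ▸ hz)

/-! ### The resolvent as a function on the whole plane -/

/-- The resolvent `(T - z I)⁻¹`, with the value `0` on the spectrum of `T`. -/
def res (T : H →ₗ.[ℂ] H) (z : ℂ) : H →L[ℂ] H :=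
  open scoped Classical in
  if hz : z ∈ resolventSet T then resolvent T z hz else 0

theorem res_isResolventAt {T : H →ₗ.[ℂ] H} {z : ℂ} (hz : z ∈ resolventSet T) :
    IsResolventAt T z (res T z) := by
  rw [res, dif_pos hz]
  exact resolvent_spec T z hz

theorem res_mem_domain {T : H →ₗ.[ℂ] H} {z : ℂ} (hz : z ∈ resolventSet T) (y : H) :
    res T z y ∈ T.domain := ((res_isResolventAt hz).1 y).1

theorem shift_res {T : H →ₗ.[ℂ] H} {z : ℂ} (hz : z ∈ resolventSet T) (y : H) :
    shift T z ⟨res T z y, res_mem_domain hz y⟩ = y := ((res_isResolventAt hz).1 y).2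

theorem res_shift {T : H →ₗ.[ℂ] H} {z : ℂ} (hz : z ∈ resolventSet T) (x : T.domain) :
    res T z (shift T z x) = x := (res_isResolventAt hz).2 x

theorem cayley_eq {T : H →ₗ.[ℂ] H} {z : ℂ} (hz : z ∈ resolventSet T) (w : ℂ) (p : H) :
    cayley T w p z = p + (z - w) • res T z p := by
  have h1 : cayley T w p z = shift T w ⟨res T z p, res_mem_domain hz p⟩ := by
    rw [cayley, dif_pos hz]
    congr 2
    rw [res, dif_pos hz]
  rw [h1, shift_eq_shift_add T z w, shift_res hz]

theorem inner_res_left [CompleteSpace H] {T : H →ₗ.[ℂ] H} (hT : IsSelfAdjoint T)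
    {z : ℂ} (hz : z ∈ resolventSet T) (x y : H) :
    inner ℂ (res T z x) y = inner ℂ x (res T (conj z) y) := by
  have hz' := conj_mem_resolventSet hT hz
  have h := inner_shift_left hT z ⟨res T z x, res_mem_domain hz x⟩
    ⟨res T (conj z) y, res_mem_domain hz' y⟩
  rw [shift_res hz, shift_res hz'] at h
  exact h.symm

theorem norm_res_le [CompleteSpace H] {T : H →ₗ.[ℂ] H} (hT : IsSelfAdjoint T)
    {z : ℂ} (hz : z.im ≠ 0) (y : H) : |z.im| * ‖res T z y‖ ≤ ‖y‖ := by
  have hz' := mem_resolventSet_of_im_ne_zero hT hz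
  have h := abs_im_mul_norm_le hT z ⟨res T z y, res_mem_domain hz' y⟩
  rwa [shift_res hz'] at h

theorem inner_cayley_left [CompleteSpace H] {T : H →ₗ.[ℂ] H} (hT : IsSelfAdjoint T)
    {z : ℂ} (hz : z ∈ resolventSet T) (w : ℂ) (p y : H) :
    inner ℂ (cayley T w p z) y = inner ℂ p (y + (conj z - conj w) • res T (conj z) y) := by
  rw [cayley_eq hz, inner_add_left, inner_add_right, inner_smul_left, inner_smul_right,
    inner_res_left hT hz, _root_.map_sub]

theorem cayley_ne_zero {T : H →ₗ.[ℂ] H} {z w : ℂ} (hz : z ∈ resolventSet T)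
    (hw : w ∈ resolventSet T) {p : H} (hp : p ≠ 0) : cayley T w p z ≠ 0 := by
  intro h
  rw [cayley_eq hz] at h
  have hS : shift T w ⟨res T z p, res_mem_domain hz p⟩ = 0 := by
    rw [shift_eq_shift_add T z w, shift_res hz, h]
  have h0 := congrArg Subtype.val (eq_zero_of_shift_eq_zero hw hS)
  have h0' : res T z p = 0 := h0
  rw [h0', smul_zero, add_zero] at h
  exact hp h

theorem shift_mem_ranShift_iff {A T : H →ₗ.[ℂ] H} (hAT : A ≤ T) {z : ℂ}
    (hz : z ∈ resolventSet T) (x : T.domain) :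
    shift T z x ∈ ranShift A z ↔ (x : H) ∈ A.domain := by
  constructor
  · rintro ⟨x', hx'⟩
    have h : shift T z (x - ⟨x', hAT.1 x'.2⟩) = 0 := by
      rw [_root_.map_sub, shift_eq_of_le hAT, hx', sub_self]
    have := sub_eq_zero.1 (eq_zero_of_shift_eq_zero hz h)
    rw [this]
    exact x'.2
  · intro hx
    exact ⟨⟨x, hx⟩, (shift_eq_of_le hAT z ⟨x, hx⟩).symm⟩

/-- The generalized Cayley transform of a vector spanning `ran (A - w̄ I)ᗮ` spans
`ran (A - z̄ I)ᗮ`. -/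
theorem mem_ranShift_iff_inner_cayley [CompleteSpace H] {A T : H →ₗ.[ℂ] H} (hAT : A ≤ T)
    (hT : IsSelfAdjoint T) {z w : ℂ} (hz : z ∈ resolventSet T) (hw : w ∈ resolventSet T) {p : H}
    (hp : ∀ y, y ∈ ranShift A (conj w) ↔ inner ℂ p y = 0) (y : H) :
    y ∈ ranShift A (conj z) ↔ inner ℂ (cayley T w p z) y = 0 := by
  have hz' := conj_mem_resolventSet hT hz
  have hw' := conj_mem_resolventSet hT hw
  have h1 := shift_mem_ranShift_iff hAT hz' ⟨res T (conj z) y, res_mem_domain hz' y⟩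
  have h2 := shift_mem_ranShift_iff hAT hw' ⟨res T (conj z) y, res_mem_domain hz' y⟩
  rw [shift_res hz'] at h1
  rw [shift_eq_shift_add T (conj z) (conj w), shift_res hz', hp] at h2
  rw [h1, ← h2, inner_cayley_left hT hz]

/-! ### The deficiency spaces -/

/-- If a closed subspace has a one-dimensional orthogonal complement, spanned by `p`, it is the
orthogonal complement of `p`. -/
theorem mem_iff_inner_eq_zero_of_finrank [CompleteSpace H] {V : Submodule ℂ H}
    (hV : IsClosed (V : Set H)) (h1 : Module.finrank ℂ Vᗮ = 1) :
    ∃ p ≠ 0, ∀ y, y ∈ V ↔ inner ℂ p y = 0 := by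
  obtain ⟨p, hp0, hp⟩ := finrank_eq_one_iff'.1 h1
  have : CompleteSpace V := hV.completeSpace_coe
  refine ⟨p, fun h => hp0 (Subtype.ext h), fun y => ?_⟩
  constructor
  · intro hy
    exact (Submodule.mem_orthogonal' _ _).1 p.2 y hy
  · intro hy
    rw [← Submodule.orthogonal_orthogonal V, Submodule.mem_orthogonal]
    intro u hu
    obtain ⟨c, hc⟩ := hp ⟨u, hu⟩
    have : u = c • (p : H) := (congrArg Subtype.val hc).symm
    rw [this, inner_smul_left, hy, mul_zero]

theorem exists_smul_eq_of_orthogonal {V : Submodule ℂ H} {p q : H}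
    (hp : ∀ y, y ∈ V ↔ inner ℂ p y = 0) (hq : ∀ y ∈ V, inner ℂ q y = 0) :
    ∃ c : ℂ, q = c • p := by
  by_cases hp0 : p = 0
  · refine ⟨0, ?_⟩
    have := hq q ((hp q).2 (by rw [hp0, inner_zero_left]))
    rw [inner_self_eq_zero.1 this, zero_smul]
  have hpp : (inner ℂ p p : ℂ) ≠ 0 := inner_self_ne_zero.2 hp0
  set c := (inner ℂ p q : ℂ) / inner ℂ p p with hc
  refine ⟨c, ?_⟩
  have hmem : inner ℂ p (q - c • p) = 0 := by
    rw [inner_sub_right, inner_smul_right, hc, div_mul_cancel₀ _ hpp, sub_self]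
  have h2 := hq _ ((hp _).2 hmem)
  have h3 : inner ℂ (q - c • p) (q - c • p) = 0 := by
    rw [inner_sub_left, h2, inner_smul_left, hmem]; simp
  exact sub_eq_zero.1 (inner_self_eq_zero.1 h3)

/-- At a point `z₀` of the resolvent set of a selfadjoint extension, every nonzero vector of
`Ker (A* - z₀ I)` spans it; that this space is one-dimensional is transported from the point
`i` by the generalized Cayley transform. -/
theorem mem_ranShift_conj_iff [CompleteSpace H] {A T : H →ₗ.[ℂ] H} (hA : MemSymR11 A)
    (hT : IsSelfAdjointExtension A T) {z₀ : ℂ} (hz₀ : z₀ ∈ resolventSet T) {ψ₀ : H}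
    (hψ₀ : ψ₀ ∈ kerShift A† z₀) (hψ₀_ne : ψ₀ ≠ 0) (y : H) :
    y ∈ ranShift A (conj z₀) ↔ inner ℂ ψ₀ y = 0 := by
  obtain ⟨c, hc, hbd⟩ := hA.regular (conj Complex.I)
  have hker : kerShift A† Complex.I = (ranShift A (conj Complex.I))ᗮ := by
    ext v
    rw [mem_kerShift_adjoint_iff hA.dense_domain, Submodule.mem_orthogonal']
    exact ⟨fun h u ⟨x, hx⟩ => hx ▸ h x, fun h x => h _ ⟨x, rfl⟩⟩
  have h1 := hA.deficiency_pos
  rw [hker] at h1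
  obtain ⟨p, hp0, hp⟩ := mem_iff_inner_eq_zero_of_finrank (isClosed_ranShift hA.closed hc hbd) h1
  have hI : Complex.I ∈ resolventSet T := mem_resolventSet_of_im_ne_zero hT.2 (by simp)
  have hz := mem_ranShift_iff_inner_cayley hT.1 hT.2 hz₀ hI hp
  obtain ⟨a, ha⟩ := exists_smul_eq_of_orthogonal hz (q := ψ₀) (by
    rintro _ ⟨x, rfl⟩
    exact (mem_kerShift_adjoint_iff hA.dense_domain).1 hψ₀ x)
  have ha0 : a ≠ 0 := by
    rintro rfl
    exact hψ₀_ne (by rw [ha, zero_smul])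
  rw [hz y, ha, inner_smul_left]
  simp [ha0]

/-! ### Analyticity of the resolvent -/

/-- The resolvent is holomorphic in the operator norm on the interior of the resolvent set. -/
theorem differentiableAt_res [CompleteSpace H] {T : H →ₗ.[ℂ] H} {z : ℂ}
    (hz : ∀ᶠ w in 𝓝 z, w ∈ resolventSet T) : DifferentiableAt ℂ (res T) z := by
  have hz0 := hz.self_of_nhds
  -- `R(w) = R(z) (1 - (w - z) R(z))⁻¹` for `w` near `z`.
  have hd : DifferentiableAt ℂ
      (fun w : ℂ => res T z * Ring.inverse (1 - (w - z) • res T z)) z := by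
    have h1 : DifferentiableAt ℂ (fun w : ℂ => (1 : H →L[ℂ] H) - (w - z) • res T z) z := by
      fun_prop
    have h2 : DifferentiableAt ℂ (Ring.inverse : (H →L[ℂ] H) → _)
        ((1 : H →L[ℂ] H) - (z - z) • res T z) := by
      apply differentiableAt_inverse
      simp
    exact (differentiableAt_const _).mul
      (DifferentiableAt.comp z (f := fun w : ℂ => (1 : H →L[ℂ] H) - (w - z) • res T z) h2 h1)
  refine hd.congr_of_eventuallyEq ?_
  have hu : ∀ᶠ w in 𝓝 z, IsUnit ((1 : H →L[ℂ] H) - (w - z) • res T z) := by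
    have hc : ContinuousAt (fun w : ℂ => (1 : H →L[ℂ] H) - (w - z) • res T z) z := by fun_prop
    exact hc.eventually_mem (s := {x | IsUnit x}) (Units.isOpen.mem_nhds (by simp))
  filter_upwards [hz, hu] with w hw hwu
  have key : res T w * (1 - (w - z) • res T z) = res T z := by
    ext y
    have h := shift_eq_shift_add T z w ⟨res T z y, res_mem_domain hz0 y⟩
    rw [shift_res hz0] at h
    have h2 := res_shift hw ⟨res T z y, res_mem_domain hz0 y⟩
    rw [h] at h2
    have h3 : y - (w - z) • res T z y = y + (z - w) • res T z y := by
      rw [sub_eq_add_neg, ← neg_smul, neg_sub]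
    change res T w (y - (w - z) • res T z y) = res T z y
    rw [h3]
    exact h2
  calc res T w = res T w * ((1 - (w - z) • res T z) * Ring.inverse (1 - (w - z) • res T z)) := by
        rw [Ring.mul_inverse_cancel _ hwu, mul_one]
    _ = _ := by rw [← mul_assoc, key]

/-! ### Growth and decay of the Cayley transform -/

/-- The Cayley transform is `O((1 + |z|) / |Im z|)`, because `‖(T - z I)⁻¹‖ ≤ 1 / |Im z|`. -/
theorem abs_im_mul_norm_cayley_le [CompleteSpace H] {T : H →ₗ.[ℂ] H} (hT : IsSelfAdjoint T)
    (w : ℂ) (p : H) {z : ℂ} (hz : z.im ≠ 0) :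
    |z.im| * ‖cayley T w p z‖ ≤ ((2 + ‖w‖) * ‖p‖) * (1 + ‖z‖) := by
  rw [cayley_eq (mem_resolventSet_of_im_ne_zero hT hz)]
  have h1 : |z.im| * ‖res T z p‖ ≤ ‖p‖ := norm_res_le hT hz p
  have h2 : |z.im| ≤ ‖z‖ := Complex.abs_im_le_norm z
  have h3 : ‖z - w‖ ≤ ‖z‖ + ‖w‖ := norm_sub_le _ _
  calc |z.im| * ‖p + (z - w) • res T z p‖
      ≤ |z.im| * (‖p‖ + ‖z - w‖ * ‖res T z p‖) := by
        gcongr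
        exact (norm_add_le _ _).trans (by rw [norm_smul])
    _ = |z.im| * ‖p‖ + ‖z - w‖ * (|z.im| * ‖res T z p‖) := by ring
    _ ≤ ‖z‖ * ‖p‖ + (‖z‖ + ‖w‖) * ‖p‖ := by gcongr
    _ ≤ ((2 + ‖w‖) * ‖p‖) * (1 + ‖z‖) := by
        have := norm_nonneg p
        have := norm_nonneg w
        have := norm_nonneg z
        have := mul_nonneg (norm_nonneg p) (norm_nonneg w)
        have := mul_nonneg this (norm_nonneg z)
        nlinarith

/-- `(1 + (z - w) R(z)) p → 0` as `z → ∞` along the imaginary axis: clear for `p` in the domain,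
and the operators are uniformly bounded there. -/
theorem tendsto_cayley_mul_I [CompleteSpace H] {T : H →ₗ.[ℂ] H} (hT : IsSelfAdjoint T)
    (w : ℂ) (p : H) :
    Filter.Tendsto (fun t : ℝ => cayley T w p (t * Complex.I)) (Filter.cocompact ℝ) (𝓝 0) := by
  have hnorm : Filter.Tendsto (fun t : ℝ => |t|) (Filter.cocompact ℝ) Filter.atTop :=
    tendsto_norm_cocompact_atTop
  rw [Metric.tendsto_nhds]
  intro ε hε
  set K := 2 + ‖w‖ with hK
  have hKpos : 0 < K := by positivity
  obtain ⟨q, hq, hpq⟩ := Metric.mem_closure_iff.1 (hT.dense_domain p) (ε / (4 * K)) (by positivity)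
  set C := ‖shift T w ⟨q, hq⟩‖ with hC
  filter_upwards [hnorm.eventually_ge_atTop 1, hnorm.eventually_gt_atTop (2 * C / ε)] with t ht1 ht2
  have ht0 : 0 < |t| := by linarith
  have him : ((t : ℂ) * Complex.I).im = t := by simp
  have hnz : ‖(t : ℂ) * Complex.I‖ = |t| := by simp
  have htne : ((t : ℂ) * Complex.I).im ≠ 0 := by
    rw [him]; exact abs_pos.1 ht0
  have hz := mem_resolventSet_of_im_ne_zero hT htne
  have hsplit : cayley T w p (t * Complex.I) =
      cayley T w (p - q) (t * Complex.I) + res T (t * Complex.I) (shift T w ⟨q, hq⟩) := by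
    have h1 := res_shift hz ⟨q, hq⟩
    rw [shift_eq_shift_add T ((t : ℂ) * Complex.I) w, _root_.map_add, h1, _root_.map_smul,
      cayley_eq hz, cayley_eq hz, _root_.map_sub, smul_sub]
    simp only
    abel
  have h1 := abs_im_mul_norm_cayley_le hT w (p - q) htne
  rw [him, hnz, ← hK] at h1
  have h2 := norm_res_le hT htne (shift T w ⟨q, hq⟩)
  rw [him, ← hC] at h2
  rw [dist_eq_norm] at hpq
  have h3 : ‖cayley T w (p - q) (t * Complex.I)‖ ≤ K * ‖p - q‖ * 2 := by
    refine le_of_mul_le_mul_left (h1.trans ?_) ht0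
    have : 0 ≤ K * ‖p - q‖ := by positivity
    nlinarith
  have h4 : K * ‖p - q‖ * 2 < ε / 2 := by
    have : K * ‖p - q‖ < K * (ε / (4 * K)) := by gcongr
    have h5 : K * (ε / (4 * K)) = ε / 4 := by field_simp
    linarith
  have h5 : ‖res T (t * Complex.I) (shift T w ⟨q, hq⟩)‖ < ε / 2 := by
    have h6 : 2 * C < |t| * ε := (div_lt_iff₀ hε).1 ht2
    have h7 : |t| * ‖res T (t * Complex.I) (shift T w ⟨q, hq⟩)‖ < |t| * (ε / 2) := by linarith
    exact lt_of_mul_lt_mul_left h7 ht0.le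
  rw [dist_zero_right, hsplit]
  exact (norm_add_le _ _).trans_lt (by linarith)

/-! ### Eigenvalues of a selfadjoint extension -/

/-- The domain of `A` is the kernel, in the domain of `T`, of the linear functional
`x ↦ ⟪ψ₀, (T - z̄₀ I) x⟫`. -/
theorem mem_domain_iff_inner_shift [CompleteSpace H] {A T : H →ₗ.[ℂ] H} (hAT : A ≤ T)
    (hT : IsSelfAdjoint T) {z₀ : ℂ} (hz₀ : z₀ ∈ resolventSet T) {ψ₀ : H}
    (hψ : ∀ y, y ∈ ranShift A (conj z₀) ↔ inner ℂ ψ₀ y = 0) (x : T.domain) :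
    (x : H) ∈ A.domain ↔ inner ℂ ψ₀ (shift T (conj z₀) x) = 0 := by
  rw [← shift_mem_ranShift_iff hAT (conj_mem_resolventSet hT hz₀), hψ]

/-- The domain of `A` has codimension at most one in that of `T`. -/
theorem exists_sub_smul_mem_domain [CompleteSpace H] {A T : H →ₗ.[ℂ] H} (hAT : A ≤ T)
    (hT : IsSelfAdjoint T) {z₀ : ℂ} (hz₀ : z₀ ∈ resolventSet T) {ψ₀ : H}
    (hψ : ∀ y, y ∈ ranShift A (conj z₀) ↔ inner ℂ ψ₀ y = 0) {v : T.domain}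
    (hv : (v : H) ∉ A.domain) (x : T.domain) : ∃ c : ℂ, (x - c • v : H) ∈ A.domain := by
  have hdom := mem_domain_iff_inner_shift hAT hT hz₀ hψ
  rw [hdom] at hv
  set c : ℂ := inner ℂ ψ₀ (shift T (conj z₀) x) / inner ℂ ψ₀ (shift T (conj z₀) v) with hc
  refine ⟨c, (hdom (x - c • v)).2 ?_⟩
  rw [_root_.map_sub, _root_.map_smul, inner_sub_right, inner_smul_right, hc,
    div_mul_cancel₀ _ hv, sub_self]

/-- With `v` outside the domain of `A`, `ran (T - z I) = ran (A - z I) + span {(T - z I) v}`. -/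
theorem ranShift_eq_sup {A T : H →ₗ.[ℂ] H} (hAT : A ≤ T) {v : T.domain}
    (hv : ∀ x : T.domain, ∃ c : ℂ, (x - c • v : H) ∈ A.domain) (z : ℂ) :
    ranShift T z = ranShift A z ⊔ Submodule.span ℂ {shift T z v} := by
  apply le_antisymm
  · rintro _ ⟨x, rfl⟩
    obtain ⟨c, hc⟩ := hv x
    have h : shift T z x = shift A z ⟨_, hc⟩ + c • shift T z v := by
      rw [← shift_eq_of_le hAT, ← _root_.map_smul, ← _root_.map_add]
      congr 1
      exact Subtype.ext (sub_add_cancel _ _).symm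
    rw [h]
    exact Submodule.add_mem_sup ⟨_, rfl⟩
      (Submodule.smul_mem _ _ (Submodule.mem_span_singleton_self _))
  · refine sup_le (ranShift_mono hAT z) ?_
    rw [Submodule.span_singleton_le_iff_mem]
    exact ⟨v, rfl⟩

theorem eq_zero_of_isRegular {A : H →ₗ.[ℂ] H} (hA : IsRegular A) {z : ℂ} {x : A.domain}
    (hx : shift A z x = 0) : (x : H) = 0 := by
  obtain ⟨c, hc, hbd⟩ := hA z
  have h := hbd x
  rw [hx, norm_zero] at h
  by_contra hne
  have := mul_pos hc (norm_pos_iff.2 hne)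
  linarith

theorem isClosed_ranShift_of_isRegular [CompleteSpace H] {A : H →ₗ.[ℂ] H} (hA : IsRegular A)
    (hcl : A.IsClosed) (z : ℂ) : IsClosed (ranShift A z : Set H) := by
  obtain ⟨c, hc, hbd⟩ := hA z
  exact isClosed_ranShift hcl hc hbd

/-- Points of the spectrum of a selfadjoint extension of a regular operator are eigenvalues:
`ran (T - z I)` is closed because it exceeds the closed `ran (A - z I)` by one dimension. -/
theorem exists_eigenvector [CompleteSpace H] {A T : H →ₗ.[ℂ] H} (hAT : A ≤ T)
    (hT : IsSelfAdjoint T) (hreg : IsRegular A) (hcl : A.IsClosed)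
    {z₀ : ℂ} (hz₀ : z₀ ∈ resolventSet T) {ψ₀ : H} (hψ₀ : ψ₀ ≠ 0)
    (hψ : ∀ y, y ∈ ranShift A (conj z₀) ↔ inner ℂ ψ₀ y = 0) {z : ℂ} (hz : z ∉ resolventSet T) :
    ∃ e : T.domain, ‖(e : H)‖ = 1 ∧ shift T z e = 0 := by
  by_contra! hcon
  have hinj : ∀ x : T.domain, shift T z x = 0 → x = 0 := by
    intro x hx
    by_contra hne
    have hne' : ‖(x : H)‖ ≠ 0 := fun h => hne (Subtype.ext (norm_eq_zero.1 h))
    refine hcon (((‖(x : H)‖ : ℂ)⁻¹) • x) ?_ (by rw [_root_.map_smul, hx, smul_zero])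
    rw [Submodule.coe_smul, norm_smul]
    simp [hne']
  have hz₀' := conj_mem_resolventSet hT hz₀
  -- `v = (T - z̄₀ I)⁻¹ ψ₀` is outside the domain of `A`, as `⟪ψ₀, (T - z̄₀ I) v⟫ = ‖ψ₀‖² ≠ 0`.
  obtain ⟨v, hv⟩ : ∃ v : T.domain, (v : H) ∉ A.domain := by
    refine ⟨⟨res T (conj z₀) ψ₀, res_mem_domain hz₀' ψ₀⟩, fun h => ?_⟩
    rw [mem_domain_iff_inner_shift hAT hT hz₀ hψ ⟨res T (conj z₀) ψ₀, _⟩, shift_res hz₀'] at h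
    exact hψ₀ (inner_self_eq_zero.1 h)
  have hsup := ranShift_eq_sup hAT (exists_sub_smul_mem_domain hAT hT hz₀ hψ hv) z
  refine hz (mem_resolventSet_of_isClosed hT ?_ hinj ?_)
  · rw [hsup]
    exact Submodule.isClosed_sup_finiteDimensional _ _ (isClosed_ranShift_of_isRegular hreg hcl z)
  · rwa [conj_eq_of_notMem_resolventSet hT hz]

theorem eigenvector_notMem_domain {A T : H →ₗ.[ℂ] H} {l : ℂ} {e : T.domain}
    (hAT : A ≤ T) (hreg : IsRegular A) (he : ‖(e : H)‖ = 1)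
    (hTe : shift T l e = 0) : (e : H) ∉ A.domain := by
  intro h
  have h0 : (e : H) = 0 := eq_zero_of_isRegular hreg (x := ⟨e, h⟩)
    ((shift_eq_of_le hAT l ⟨e, h⟩).symm.trans hTe)
  rw [h0, norm_zero] at he
  exact zero_ne_one he

section Eigenvector

variable [CompleteSpace H] {A T : H →ₗ.[ℂ] H} {z₀ l : ℂ} {ψ₀ : H} {e : T.domain}

/-- `ran (A - λ I)` is the orthogonal complement of the eigenvector at `λ`. -/
theorem mem_ranShift_iff_inner_eigenvector (hAT : A ≤ T) (hT : IsSelfAdjoint T)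
    (hreg : IsRegular A) (hcl : A.IsClosed) (hl : conj l = l)
    (hdom : ∀ x : T.domain, ∃ c : ℂ, (x - c • e : H) ∈ A.domain)
    (hTe : shift T l e = 0) (y : H) :
    y ∈ ranShift A l ↔ inner ℂ (e : H) y = 0 := by
  constructor
  · rintro ⟨x, rfl⟩
    have h := inner_shift_left hT l e ⟨x, hAT.1 x.2⟩
    rw [hTe, inner_zero_left, hl, shift_eq_of_le hAT] at h
    exact h.symm
  · intro hy
    have hran : ranShift T l = ranShift A l := by
      rw [ranShift_eq_sup hAT hdom, hTe, Submodule.span_zero_singleton, sup_bot_eq]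
    have hclT := isClosed_ranShift_of_isRegular hreg hcl l
    have : CompleteSpace (ranShift A l) := hclT.completeSpace_coe
    rw [← Submodule.orthogonal_orthogonal (ranShift A l), Submodule.mem_orthogonal]
    intro u hu
    rw [← hran, Submodule.mem_orthogonal'] at hu
    obtain ⟨hu1, hu2⟩ := exists_shift_eq_zero hT (z := l) (y := u) (by
      intro x
      rw [hl]
      exact hu _ ⟨x, rfl⟩)
    obtain ⟨c, hc⟩ := hdom ⟨u, hu1⟩
    have h0 : shift A l ⟨_, hc⟩ = 0 := by
      rw [← shift_eq_of_le hAT]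
      have : (⟨_, hAT.1 hc⟩ : T.domain) = ⟨u, hu1⟩ - c • e := rfl
      rw [this, _root_.map_sub, _root_.map_smul, hu2, hTe]
      simp
    have h1 : u - c • (e : H) = 0 := eq_zero_of_isRegular hreg h0
    rw [sub_eq_zero.1 h1, inner_smul_left, hy, mul_zero]

/-- Near an eigenvalue the resolvent is bounded on the complement of the eigenvector. -/
theorem exists_norm_res_le_of_orthogonal (hAT : A ≤ T) (hT : IsSelfAdjoint T)
    (hreg : IsRegular A) (hl : conj l = l)
    (hdom : ∀ x : T.domain, ∃ c : ℂ, (x - c • e : H) ∈ A.domain) (hTe : shift T l e = 0) :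
    ∃ δ > 0, ∃ C : ℝ, ∀ w ∈ resolventSet T, w ≠ l → ‖w - l‖ < δ → ∀ y : H,
      inner ℂ (e : H) y = 0 → ‖res T w y‖ ≤ C * ‖y‖ := by
  obtain ⟨c, hc, hbd⟩ := hreg l
  refine ⟨c / 2, by positivity, 2 / c, fun w hw hwl hwd y hy => ?_⟩
  set u : T.domain := ⟨res T w y, res_mem_domain hw y⟩ with hu
  have hsu : shift T w u = y := shift_res hw y
  have hue : inner ℂ (e : H) (u : H) = 0 := by
    have h := inner_shift_left hT l e u
    rw [hTe, inner_zero_left, hl, shift_eq_shift_add T w l, hsu, inner_add_right, hy, zero_add,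
      inner_smul_right] at h
    exact (mul_eq_zero.1 h.symm).resolve_left (sub_ne_zero.2 hwl)
  obtain ⟨a, ha⟩ := hdom u
  have h1 : c * ‖(u : H)‖ ≤ ‖shift T l u‖ := by
    have h2 := hbd ⟨_, ha⟩
    have h3 : shift A l ⟨_, ha⟩ = shift T l u := by
      rw [← shift_eq_of_le hAT]
      have : (⟨_, hAT.1 ha⟩ : T.domain) = u - a • e := rfl
      rw [this, _root_.map_sub, _root_.map_smul, hTe]
      simp
    rw [h3] at h2
    refine le_trans ?_ h2
    have h4 : ‖(u : H)‖ ≤ ‖(u : H) - a • (e : H)‖ := by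
      have h5 : inner ℂ (u : H) (a • (e : H)) = 0 := by
        rw [inner_smul_right, ← inner_conj_symm, hue]; simp
      have h6 := norm_sub_sq (𝕜 := ℂ) (u : H) (a • (e : H))
      rw [h5] at h6
      simp only [_root_.map_zero, mul_zero, sub_zero] at h6
      exact (sq_le_sq₀ (norm_nonneg _) (norm_nonneg _)).1 (by rw [h6]; nlinarith [sq_nonneg ‖a • (e : H)‖])
    exact mul_le_mul_of_nonneg_left h4 hc.le
  have h2 : ‖shift T l u‖ ≤ ‖y‖ + ‖w - l‖ * ‖(u : H)‖ := by
    rw [shift_eq_shift_add T w l, hsu, ← norm_smul]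
    exact norm_add_le _ _
  have h3 : ‖w - l‖ * ‖(u : H)‖ ≤ c / 2 * ‖(u : H)‖ := by gcongr
  have h4 : c / 2 * ‖(u : H)‖ ≤ ‖y‖ := by linarith
  calc ‖(u : H)‖ = 2 / c * (c / 2 * ‖(u : H)‖) := by field_simp
    _ ≤ 2 / c * ‖y‖ := by gcongr

/-- An eigenvector of `T` orthogonal to `ψ₀` would lie in the domain of `A`, against regularity. -/
theorem inner_eigenvector_ne_zero (hAT : A ≤ T) (hT : IsSelfAdjoint T) (hreg : IsRegular A)
    (hz₀ : z₀ ∈ resolventSet T) (hψ : ∀ y, y ∈ ranShift A (conj z₀) ↔ inner ℂ ψ₀ y = 0)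
    (he : ‖(e : H)‖ = 1) (hTe : shift T l e = 0) : inner ℂ (e : H) ψ₀ ≠ 0 := by
  intro h0
  apply eigenvector_notMem_domain hAT hreg he hTe
  rw [mem_domain_iff_inner_shift hAT hT hz₀ hψ, shift_eq_shift_add T l, hTe, zero_add,
    inner_smul_right, ← inner_conj_symm, h0]
  simp

/-- The value of `ξ` at an eigenvalue: the pole of the resolvent, whose residue is the projection
onto the eigenvector, is cancelled by the simple zero of `g`. -/
theorem tendsto_smul_cayley (hAT : A ≤ T) (hT : IsSelfAdjoint T)
    (hreg : IsRegular A) (hl : conj l = l)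
    (hdom : ∀ x : T.domain, ∃ c : ℂ, (x - c • e : H) ∈ A.domain)
    (he : ‖(e : H)‖ = 1) (hTe : shift T l e = 0)
    {g : ℂ → ℂ} (hg : DifferentiableAt ℂ g l) (hgl : g l = 0)
    (hρ : ∀ᶠ w in 𝓝[≠] l, w ∈ resolventSet T) :
    Filter.Tendsto (fun w => g w • cayley T z₀ ψ₀ w) (𝓝[≠] l)
      (𝓝 ((-deriv g l * (l - z₀) * inner ℂ (e : H) ψ₀) • (e : H))) := by
  set a : ℂ := inner ℂ (e : H) ψ₀ with ha
  set y := ψ₀ - a • (e : H) with hy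
  have hye : inner ℂ (e : H) y = 0 := by
    rw [hy, inner_sub_right, inner_smul_right, inner_self_eq_norm_sq_to_K, he, ← ha]
    simp
  obtain ⟨δ, hδ, C, hC⟩ := exists_norm_res_le_of_orthogonal hAT hT hreg hl hdom hTe
  have hnear : ∀ᶠ w in 𝓝[≠] l, ‖w - l‖ < δ := by
    refine eventually_nhdsWithin_of_eventually_nhds ?_
    filter_upwards [Metric.ball_mem_nhds l hδ] with w hw
    rwa [← dist_eq_norm]
  have hg0 : Filter.Tendsto g (𝓝[≠] l) (𝓝 0) := by
    have h := hg.continuousAt.tendsto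
    rw [hgl] at h
    exact h.mono_left nhdsWithin_le_nhds
  have hid : Filter.Tendsto (fun w : ℂ => w - z₀) (𝓝[≠] l) (𝓝 (l - z₀)) :=
    Filter.Tendsto.mono_left ((continuous_id.sub continuous_const).tendsto l) nhdsWithin_le_nhds
  have hslope : Filter.Tendsto (fun w => g w / (w - l)) (𝓝[≠] l) (𝓝 (deriv g l)) := by
    have h := hasDerivAt_iff_tendsto_slope.1 hg.hasDerivAt
    refine h.congr fun w => ?_
    rw [slope_def_field, hgl, sub_zero]
  -- the part orthogonal to the eigenvector tends to `0`.
  have hrest : Filter.Tendsto (fun w => (g w * (w - z₀)) • res T w y) (𝓝[≠] l) (𝓝 0) := by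
    apply squeeze_zero_norm' (a := fun w => ‖g w * (w - z₀)‖ * (C * ‖y‖))
    · filter_upwards [hρ, hnear, self_mem_nhdsWithin] with w hw1 hw2 hw3
      rw [norm_smul]
      gcongr
      exact hC w hw1 hw3 hw2 y hye
    · have h := ((hg0.mul hid).norm).mul_const (C * ‖y‖)
      simpa using h
  have hmain : Filter.Tendsto (fun w => g w • ψ₀ + (-(g w / (w - l)) * (w - z₀) * a) • (e : H) +
      (g w * (w - z₀)) • res T w y) (𝓝[≠] l)
      (𝓝 ((0 : ℂ) • ψ₀ + (-deriv g l * (l - z₀) * a) • (e : H) + 0)) :=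
    ((hg0.smul_const _).add (((hslope.neg.mul hid).mul_const a).smul_const _)).add hrest
  rw [zero_smul, zero_add, add_zero] at hmain
  refine hmain.congr' ?_
  filter_upwards [hρ, self_mem_nhdsWithin] with w hw hwl
  have hwl' : w - l ≠ 0 := sub_ne_zero.2 hwl
  have hre : res T w (e : H) = (-(w - l)⁻¹) • (e : H) := by
    have h := res_shift hw e
    rw [shift_eq_shift_add T l w, hTe, zero_add, _root_.map_smul] at h
    calc res T w (e : H) = (-(w - l)⁻¹) • ((l - w) • res T w (e : H)) := by
          rw [smul_smul, show -(w - l)⁻¹ * (l - w) = 1 by field_simp; ring, one_smul]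
      _ = _ := by rw [h]
  have hψ : ψ₀ = a • (e : H) + y := by rw [hy]; abel
  have hres : res T w ψ₀ = (a * -(w - l)⁻¹) • (e : H) + res T w y := by
    conv_lhs => rw [hψ, _root_.map_add, _root_.map_smul, hre, smul_smul]
  rw [cayley_eq hw, hres]
  simp only [smul_add, smul_smul, add_assoc]
  congr 3
  field_simp

end Eigenvector

/-! ### Entire functions -/

/-- A zero-free entire function has an entire logarithm, a primitive of `f' / f`. -/
theorem exists_differentiable_exp_eq {f : ℂ → ℂ} (hf : Differentiable ℂ f)
    (hf0 : ∀ z, f z ≠ 0) : ∃ h : ℂ → ℂ, Differentiable ℂ h ∧ ∀ z, f z = Complex.exp (h z) := by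
  have hq : Differentiable ℂ fun z => deriv f z / f z := fun z =>
    (hf.deriv z).div (hf z) (hf0 z)
  obtain ⟨k, hk0, hk⟩ :=
    Complex.IsExactOn.with_val_at hq.isExactOn_univ 0 (Complex.log (f 0))
  have hkd : ∀ z, HasDerivAt k (deriv f z / f z) z := fun z => hk z trivial
  refine ⟨k, fun z => (hkd z).differentiableAt, fun z => ?_⟩
  -- `f e^{-k}` has derivative zero, and its value at `0` is `1`.
  have hd : ∀ w, HasDerivAt (fun w => f w * Complex.exp (-k w)) 0 w := by
    intro w
    have h := (hf w).hasDerivAt.mul (hkd w).neg.cexp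
    refine h.congr_deriv ?_
    have := hf0 w
    simp only [Pi.neg_apply]
    field_simp
    ring
  have hconst := is_const_of_deriv_eq_zero (fun w => (hd w).differentiableAt)
    (fun w => (hd w).deriv) z 0
  simp only [hk0, Complex.exp_neg, Complex.exp_log (hf0 0)] at hconst
  rw [mul_inv_cancel₀ (hf0 0), mul_inv_eq_one₀ (Complex.exp_ne_zero _)] at hconst
  exact hconst

/-- The geometric mean of a zero-free entire function `f` and its reflection `f^#`: it is real,
zero-free, and of the same modulus as `f` on the real axis. -/
theorem exists_isRealEntire_norm_sq_eq {f : ℂ → ℂ} (hf : Differentiable ℂ f)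
    (hf0 : ∀ z, f z ≠ 0) : ∃ F : ℂ → ℂ, IsRealEntire F ∧ (∀ z, F z ≠ 0) ∧
      ∀ z, ‖F z‖ ^ 2 = ‖f z‖ * ‖f (conj z)‖ := by
  obtain ⟨h, hh, hfh⟩ := exists_differentiable_exp_eq hf hf0
  have hs : Differentiable ℂ (fun z => conj (h (conj z))) := fun z => by
    have := (hh (conj z)).conj_conj
    rw [Complex.conj_conj] at this
    exact this
  refine ⟨fun z => Complex.exp ((h z + conj (h (conj z))) / 2),
    ⟨((hh.add hs).div_const 2).cexp, fun z => ?_⟩, fun z => Complex.exp_ne_zero _, fun z => ?_⟩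
  · simp only [← Complex.exp_conj, map_div₀, _root_.map_add, Complex.conj_conj, map_ofNat]
    rw [add_comm]
  · rw [hfh, hfh, Complex.norm_exp, Complex.norm_exp, Complex.norm_exp, ← Real.exp_add, sq,
      ← Real.exp_add]
    congr 1
    simp

theorem differentiable_of_continuousAt_of_punctured {f : ℂ → ℂ}
    (h : ∀ z, DifferentiableAt ℂ f z ∨
      ((∀ᶠ w in 𝓝[≠] z, DifferentiableAt ℂ f w) ∧ ContinuousAt f z)) : Differentiable ℂ f := by
  intro z
  rcases h z with h | ⟨h1, h2⟩
  · exact h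
  · exact (Complex.analyticAt_of_differentiable_on_punctured_nhds_of_continuousAt h1
      h2).differentiableAt

theorem eventually_ne_zero_of_deriv_ne_zero {g : ℂ → ℂ} (hg : Differentiable ℂ g)
    (hs : ∀ z, g z = 0 → deriv g z ≠ 0) (z : ℂ) : ∀ᶠ w in 𝓝[≠] z, g w ≠ 0 := by
  by_cases h : g z = 0
  · exact (hg z).hasDerivAt.eventually_ne (hs z h)
  · exact eventually_nhdsWithin_of_eventually_nhds ((hg z).continuousAt.eventually_ne h)

/-- An entire function is divisible by one with simple zeros if it vanishes at those zeros. -/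
theorem exists_differentiable_mul_eq {N g : ℂ → ℂ} (hN : Differentiable ℂ N)
    (hg : Differentiable ℂ g) (hs : ∀ z, g z = 0 → deriv g z ≠ 0) (h0 : ∀ z, g z = 0 → N z = 0) :
    ∃ q : ℂ → ℂ, Differentiable ℂ q ∧ ∀ z, N z = g z * q z := by
  classical
  let q : ℂ → ℂ := fun z => if g z = 0 then deriv N z / deriv g z else N z / g z
  have hq : ∀ z, g z ≠ 0 → q z = N z / g z := fun z hz => if_neg hz
  have hqd : ∀ z, g z ≠ 0 → DifferentiableAt ℂ q z := by
    intro z hz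
    refine ((hN z).div (hg z) hz).congr_of_eventuallyEq ?_
    filter_upwards [(hg z).continuousAt.eventually_ne hz] with w hw
    exact hq w hw
  refine ⟨q, differentiable_of_continuousAt_of_punctured fun z => ?_, fun z => ?_⟩
  · by_cases hz : g z = 0
    · right
      have hne := eventually_ne_zero_of_deriv_ne_zero hg hs z
      refine ⟨hne.mono hqd, ?_⟩
      rw [continuousAt_iff_punctured_nhds, show q z = deriv N z / deriv g z from if_pos hz]
      have h1 := hasDerivAt_iff_tendsto_slope.1 (hN z).hasDerivAt
      have h2 := hasDerivAt_iff_tendsto_slope.1 (hg z).hasDerivAt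
      refine (h1.div h2 (hs z hz)).congr' ?_
      filter_upwards [hne, self_mem_nhdsWithin] with w hw hwz
      have : w - z ≠ 0 := sub_ne_zero.2 hwz
      rw [hq w hw, Pi.div_apply, slope_def_field, slope_def_field, hz, h0 z hz, sub_zero, sub_zero]
      field_simp
    · exact Or.inl (hqd z hz)
  · by_cases hz : g z = 0
    · rw [hz, h0 z hz, zero_mul]
    · rw [hq z hz, mul_div_cancel₀ _ hz]

/-- A Liouville theorem: an entire function that is `O((1 + |z|) / |Im z|)` is constant. The factor
`z² - R²` has modulus `2 R |Im z|` on the circle `|z| = R` and so absorbs the singular bound. -/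
theorem eq_const_of_abs_im_mul_norm_le {q : ℂ → ℂ} (hq : Differentiable ℂ q) {C : ℝ}
    (hC : ∀ z : ℂ, |z.im| * ‖q z‖ ≤ C * (1 + ‖z‖)) (z : ℂ) : q z = q 0 := by
  apply hq.apply_eq_apply_of_bounded
  rw [isBounded_iff_forall_norm_le]
  have hC0 : 0 ≤ C := by
    have := hC 0
    simpa using this
  refine ⟨4 * C, ?_⟩
  rintro _ ⟨z, rfl⟩
  -- `z` lies well inside the circle, so that `|z² - R²|` is comparable to `R²`.
  set R : ℝ := 2 * ‖z‖ + 2 with hR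
  have hz0 := norm_nonneg z
  have hR0 : 0 < R := by positivity
  have hG : Differentiable ℂ fun w : ℂ => q w * (w ^ 2 - (R : ℂ) ^ 2) := by fun_prop
  have hbd : ∀ w ∈ frontier (Metric.ball (0 : ℂ) R),
      ‖q w * (w ^ 2 - (R : ℂ) ^ 2)‖ ≤ 2 * R * (C * (1 + R)) := by
    intro w hw
    rw [frontier_ball _ hR0.ne', mem_sphere_zero_iff_norm] at hw
    have h1 : w ^ 2 - (R : ℂ) ^ 2 = w * (w - conj w) := by
      rw [← hw, ← Complex.mul_conj']; ring
    have h2 : ‖w ^ 2 - (R : ℂ) ^ 2‖ = 2 * R * |w.im| := by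
      rw [h1, norm_mul, hw, Complex.sub_conj]
      simp
      ring
    have h3 := hC w
    rw [hw] at h3
    calc ‖q w * (w ^ 2 - (R : ℂ) ^ 2)‖ = 2 * R * (|w.im| * ‖q w‖) := by
          rw [norm_mul, h2]; ring
      _ ≤ _ := by gcongr
  have hmem : z ∈ closure (Metric.ball (0 : ℂ) R) :=
    subset_closure (by rw [mem_ball_zero_iff]; linarith)
  have h := Complex.norm_le_of_forall_mem_frontier_norm_le Metric.isBounded_ball
    hG.diffContOnCl hbd hmem
  have hlow : R ^ 2 - ‖z‖ ^ 2 ≤ ‖z ^ 2 - (R : ℂ) ^ 2‖ := by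
    have := norm_sub_norm_le ((R : ℂ) ^ 2) (z ^ 2)
    rw [norm_sub_rev] at this
    simpa [abs_of_pos hR0] using this
  rw [norm_mul] at h
  have h4 : ‖q z‖ * (R ^ 2 - ‖z‖ ^ 2) ≤ 2 * R * (C * (1 + R)) :=
    (mul_le_mul_of_nonneg_left hlow (norm_nonneg _)).trans h
  have h5 : 2 * R * (C * (1 + R)) ≤ (4 * C) * (R ^ 2 - ‖z‖ ^ 2) := by
    have : 2 * R * (1 + R) ≤ 4 * (R ^ 2 - ‖z‖ ^ 2) := by rw [hR]; nlinarith
    nlinarith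
  have hpos : 0 < R ^ 2 - ‖z‖ ^ 2 := by rw [hR]; nlinarith
  exact le_of_mul_le_mul_right (h4.trans h5) hpos

/-- Interpolation at an orthogonal family: by Bessel's inequality, data dominated by the inner
products with a fixed vector are themselves inner products with some vector. -/
theorem exists_inner_eq_of_norm_le [CompleteSpace H] {ι : Type*} {v : ι → H}
    (hv0 : ∀ i, v i ≠ 0) (hv : Pairwise fun i j => inner ℂ (v i) (v j) = 0) {a : ι → ℂ} {μ : H}
    (ha : ∀ i, ‖a i‖ ≤ ‖inner ℂ (v i) μ‖) : ∃ φ : H, ∀ i, inner ℂ (v i) φ = a i := by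
  have hn : ∀ i, (‖v i‖ : ℂ) ≠ 0 := fun i => by simpa using hv0 i
  let e : ι → H := fun i => (‖v i‖ : ℂ)⁻¹ • v i
  have he : Orthonormal ℂ e := by
    refine ⟨fun i => ?_, fun i j hij => ?_⟩
    · have := hv0 i
      simp [e, norm_smul, this]
    · change inner ℂ ((‖v i‖ : ℂ)⁻¹ • v i) ((‖v j‖ : ℂ)⁻¹ • v j) = 0
      rw [inner_smul_left, inner_smul_right, hv hij, mul_zero, mul_zero]
  let c : ι → ℂ := fun i => (‖v i‖ : ℂ)⁻¹ * a i
  have hc : Summable fun i => ‖c i‖ ^ 2 := by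
    refine Summable.of_nonneg_of_le (fun i => sq_nonneg _) (fun i => ?_)
      (he.inner_products_summable μ)
    have : ‖c i‖ ≤ ‖inner ℂ (e i) μ‖ := by
      simp only [c, e, inner_smul_left, norm_mul, RCLike.norm_conj]
      exact mul_le_mul_of_nonneg_left (ha i) (norm_nonneg _)
    gcongr
  have hsum : Summable fun i => c i • e i := by
    have h := he.orthogonalFamily.summable_iff_norm_sq_summable c
    simp only [LinearIsometry.toSpanSingleton_apply] at h
    exact h.2 hc
  refine ⟨∑' i, c i • e i, fun j => ?_⟩
  have h1 : HasSum (fun i => inner ℂ (v j) (c i • e i)) (inner ℂ (v j) (∑' i, c i • e i)) :=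
    (innerSL ℂ (v j)).hasSum hsum.hasSum
  have h2 : HasSum (fun i => inner ℂ (v j) (c i • e i)) (inner ℂ (v j) (c j • e j)) := by
    refine hasSum_single j fun i hij => ?_
    simp only [e, inner_smul_right, hv hij.symm, mul_zero]
  rw [h1.unique h2]
  simp only [c, e, inner_smul_right, inner_self_eq_norm_sq_to_K]
  have := hn j
  simp only [Complex.coe_algebraMap]
  field_simp

/-! ### The function `ξ` and the representation map -/

theorem xi_of_mem_resolventSet {T : H →ₗ.[ℂ] H} {z : ℂ} (hz : z ∈ resolventSet T) (g : ℂ → ℂ)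
    (z₀ : ℂ) (ψ₀ : H) : xi T g z₀ ψ₀ z = g z • cayley T z₀ ψ₀ z := if_pos hz

section

variable [CompleteSpace H] {A T : H →ₗ.[ℂ] H} {g : ℂ → ℂ} {z₀ : ℂ} {ψ₀ : H}

/-- At a point of the spectrum, `ξ` is continuous, and its value is an eigenvector, which spans
the orthogonal complement of `ran (A - z I)`. -/
theorem xi_of_notMem_resolventSet (hA : MemSymR11 A) (hT : IsSelfAdjointExtension A T)
    (hg : Differentiable ℂ g) (hg_zero : ∀ z, g z = 0 ↔ z ∉ resolventSet T)
    (hg_simple : ∀ z, g z = 0 → deriv g z ≠ 0) (hz₀ : z₀ ∈ resolventSet T)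
    (hψ₀ : ψ₀ ∈ kerShift A† z₀) (hψ₀_ne : ψ₀ ≠ 0) {l : ℂ} (hl : l ∉ resolventSet T) :
    xi T g z₀ ψ₀ l ≠ 0 ∧ (∃ x : T.domain, (x : H) = xi T g z₀ ψ₀ l ∧ shift T l x = 0) ∧
      (∀ y, y ∈ ranShift A (conj l) ↔ inner ℂ (xi T g z₀ ψ₀ l) y = 0) ∧
      ContinuousAt (xi T g z₀ ψ₀) l := by
  have hψ := mem_ranShift_conj_iff hA hT hz₀ hψ₀ hψ₀_ne
  have hlc := conj_eq_of_notMem_resolventSet hT.2 hl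
  obtain ⟨e, he, hTe⟩ :=
    exists_eigenvector hT.1 hT.2 hA.regular hA.closed hz₀ hψ₀_ne hψ hl
  have hdom := exists_sub_smul_mem_domain hT.1 hT.2 hz₀ hψ
    (eigenvector_notMem_domain hT.1 hA.regular he hTe)
  have hρ : ∀ᶠ w in 𝓝[≠] l, w ∈ resolventSet T :=
    (eventually_ne_zero_of_deriv_ne_zero hg hg_simple l).mono fun w hw => by
      by_contra h
      exact hw ((hg_zero w).2 h)
  have hgl := (hg_zero l).2 hl
  have hlim := tendsto_smul_cayley (z₀ := z₀) (ψ₀ := ψ₀) hT.1 hT.2 hA.regular hlc hdom he hTe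
    (hg l) hgl hρ
  set k : ℂ := -deriv g l * (l - z₀) * inner ℂ (e : H) ψ₀ with hk
  have hk0 : k ≠ 0 := by
    refine mul_ne_zero (mul_ne_zero (neg_ne_zero.2 (hg_simple l hgl)) (sub_ne_zero.2 ?_))
      (inner_eigenvector_ne_zero hT.1 hT.2 hA.regular hz₀ hψ he hTe)
    rintro rfl
    exact hl hz₀
  have hxi : xi T g z₀ ψ₀ l = k • (e : H) := (if_neg hl).trans hlim.limUnder_eq
  have he0 : (e : H) ≠ 0 := by
    intro h
    rw [h, norm_zero] at he
    exact zero_ne_one he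
  refine ⟨?_, ⟨k • e, hxi.symm, by rw [_root_.map_smul, hTe, smul_zero]⟩, fun y => ?_, ?_⟩
  · rw [hxi]
    exact smul_ne_zero hk0 he0
  · rw [hlc, hxi, inner_smul_left,
      mem_ranShift_iff_inner_eigenvector hT.1 hT.2 hA.regular hA.closed hlc hdom hTe]
    simp [hk0]
  · rw [continuousAt_iff_punctured_nhds, hxi]
    refine hlim.congr' ?_
    filter_upwards [hρ] with w hw
    rw [xi_of_mem_resolventSet hw]

/-- `ξ(z)` is a nonzero vector spanning the orthogonal complement of `ran (A - z̄ I)`. -/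
theorem xi_ne_zero_and_mem_ranShift_iff (hA : MemSymR11 A) (hT : IsSelfAdjointExtension A T)
    (hg : Differentiable ℂ g) (hg_zero : ∀ z, g z = 0 ↔ z ∉ resolventSet T)
    (hg_simple : ∀ z, g z = 0 → deriv g z ≠ 0) (hz₀ : z₀ ∈ resolventSet T)
    (hψ₀ : ψ₀ ∈ kerShift A† z₀) (hψ₀_ne : ψ₀ ≠ 0) (z : ℂ) :
    xi T g z₀ ψ₀ z ≠ 0 ∧ ∀ y, y ∈ ranShift A (conj z) ↔ inner ℂ (xi T g z₀ ψ₀ z) y = 0 := by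
  by_cases hz : z ∈ resolventSet T
  · have hgz : g z ≠ 0 := fun h => (hg_zero z).1 h hz
    rw [xi_of_mem_resolventSet hz]
    refine ⟨smul_ne_zero hgz (cayley_ne_zero hz hz₀ hψ₀_ne), fun y => ?_⟩
    rw [mem_ranShift_iff_inner_cayley hT.1 hT.2 hz hz₀
      (mem_ranShift_conj_iff hA hT hz₀ hψ₀ hψ₀_ne), inner_smul_left]
    simp [hgz]
  · have h := xi_of_notMem_resolventSet hA hT hg hg_zero hg_simple hz₀ hψ₀ hψ₀_ne hz
    exact ⟨h.1, h.2.2.1⟩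

/-- The values of `ξ` on the spectrum are pairwise orthogonal. -/
theorem inner_xi_eq_zero (hA : MemSymR11 A) (hT : IsSelfAdjointExtension A T)
    (hg : Differentiable ℂ g) (hg_zero : ∀ z, g z = 0 ↔ z ∉ resolventSet T)
    (hg_simple : ∀ z, g z = 0 → deriv g z ≠ 0) (hz₀ : z₀ ∈ resolventSet T)
    (hψ₀ : ψ₀ ∈ kerShift A† z₀) (hψ₀_ne : ψ₀ ≠ 0) {l m : ℂ} (hl : l ∉ resolventSet T)
    (hm : m ∉ resolventSet T) (hlm : l ≠ m) :
    inner ℂ (xi T g z₀ ψ₀ l) (xi T g z₀ ψ₀ m) = 0 := by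
  obtain ⟨x, hx, hx0⟩ :=
    (xi_of_notMem_resolventSet hA hT hg hg_zero hg_simple hz₀ hψ₀ hψ₀_ne hl).2.1
  obtain ⟨y, hy, hy0⟩ :=
    (xi_of_notMem_resolventSet hA hT hg hg_zero hg_simple hz₀ hψ₀ hψ₀_ne hm).2.1
  have h := inner_shift_left hT.2 l x y
  rw [hx0, inner_zero_left, conj_eq_of_notMem_resolventSet hT.2 hl, shift_eq_shift_add T m l, hy0,
    zero_add, inner_smul_right, hx, hy] at h
  exact (mul_eq_zero.1 h.symm).resolve_left (sub_ne_zero.2 hlm.symm)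

/-- `(Φ φ)(z) = g(z) ⟪ψ(z̄), φ⟫` off the spectrum. -/
theorem repMap_xi_eq (hT : IsSelfAdjoint T) (hg : ∀ z, conj (g (conj z)) = g z) {z : ℂ}
    (hz : z ∈ resolventSet T) (φ : H) :
    repMap (xi T g z₀ ψ₀) φ z = g z * inner ℂ (cayley T z₀ ψ₀ (conj z)) φ := by
  change inner ℂ (xi T g z₀ ψ₀ (conj z)) φ = _
  rw [xi_of_mem_resolventSet (conj_mem_resolventSet hT hz), inner_smul_left, hg]

/-- The elements of the representation space are entire functions. -/
theorem differentiable_repMap_xi (hA : MemSymR11 A) (hT : IsSelfAdjointExtension A T)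
    (hg : IsRealEntire g) (hg_zero : ∀ z, g z = 0 ↔ z ∉ resolventSet T)
    (hg_simple : ∀ z, g z = 0 → deriv g z ≠ 0) (hz₀ : z₀ ∈ resolventSet T)
    (hψ₀ : ψ₀ ∈ kerShift A† z₀) (hψ₀_ne : ψ₀ ≠ 0) (φ : H) :
    Differentiable ℂ (repMap (xi T g z₀ ψ₀) φ) := by
  have hρ : ∀ z, z ∈ resolventSet T → ∀ᶠ w in 𝓝 z, w ∈ resolventSet T := by
    intro z hz
    filter_upwards [(hg.1 z).continuousAt.eventually_ne fun h => (hg_zero z).1 h hz] with w hw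
    by_contra h
    exact hw ((hg_zero w).2 h)
  have hd : ∀ z, z ∈ resolventSet T → DifferentiableAt ℂ (repMap (xi T g z₀ ψ₀) φ) z := by
    intro z hz
    have h1 : DifferentiableAt ℂ
        (fun w => g w * innerSL ℂ ψ₀ (φ + (w - conj z₀) • res T w φ)) z := by
      have h2 : DifferentiableAt ℂ (fun w => res T w φ) z :=
        (differentiableAt_res (hρ z hz)).clm_apply (differentiableAt_const φ)
      exact (hg.1 z).mul ((innerSL ℂ ψ₀).differentiableAt.comp z
        (((differentiableAt_id.sub_const _).smul h2).const_add φ))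
    refine h1.congr_of_eventuallyEq ?_
    filter_upwards [hρ z hz] with w hw
    rw [repMap_xi_eq hT.2 hg.2 hw, inner_cayley_left hT.2 (conj_mem_resolventSet hT.2 hw),
      Complex.conj_conj, innerSL_apply_apply]
  refine differentiable_of_continuousAt_of_punctured fun z => ?_
  by_cases hz : z ∈ resolventSet T
  · exact Or.inl (hd z hz)
  · right
    constructor
    · refine (eventually_ne_zero_of_deriv_ne_zero hg.1 hg_simple z).mono fun w hw => hd w ?_
      by_contra h
      exact hw ((hg_zero w).2 h)
    · have hzc : conj z = z := conj_eq_of_notMem_resolventSet hT.2 hz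
      have hc := (xi_of_notMem_resolventSet hA hT hg.1 hg_zero hg_simple hz₀ hψ₀ hψ₀_ne
        hz).2.2.2
      have hc2 : ContinuousAt (fun w => xi T g z₀ ψ₀ (conj w)) z :=
        ContinuousAt.comp' (f := fun w : ℂ => conj w) (g := xi T g z₀ ψ₀)
          (by rw [hzc]; exact hc) Complex.continuous_conj.continuousAt
      exact ContinuousAt.inner hc2 continuousAt_const

end

/-- If `ran (A - z I)` is the orthogonal complement of `p ≠ 0`, then `μ` spans an algebraic
complement of it exactly when `μ` is not orthogonal to `p`. -/
theorem directSumAt_iff {A : H →ₗ.[ℂ] H} {z : ℂ} {p : H} (hp0 : p ≠ 0)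
    (hp : ∀ y, y ∈ ranShift A z ↔ inner ℂ p y = 0) (μ : H) :
    DirectSumAt A μ z ↔ inner ℂ p μ ≠ 0 := by
  constructor
  · intro h h0
    have hle : Submodule.span ℂ {μ} ≤ ranShift A z := by
      rw [Submodule.span_singleton_le_iff_mem, hp, h0]
    have htop := h.sup_eq_top
    rw [sup_eq_left.2 hle] at htop
    have : p ∈ ranShift A z := by rw [htop]; trivial
    exact hp0 (inner_self_eq_zero.1 ((hp p).1 this))
  · intro h
    constructor
    · rw [Submodule.disjoint_def]
      intro x hx hxμ
      obtain ⟨c, rfl⟩ := Submodule.mem_span_singleton.1 hxμ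
      rw [hp, inner_smul_right] at hx
      rw [(mul_eq_zero.1 hx).resolve_right h, zero_smul]
    · rw [codisjoint_iff, Submodule.eq_top_iff']
      intro x
      rw [Submodule.mem_sup]
      refine ⟨x - (inner ℂ p x / inner ℂ p μ) • μ, ?_, _,
        Submodule.smul_mem _ _ (Submodule.mem_span_singleton_self μ), sub_add_cancel _ _⟩
      rw [hp, inner_sub_right, inner_smul_right, div_mul_cancel₀ _ h, sub_self]

/-! ### Membership of the geometric mean in the representation space -/

/-- An entire function `F` with `|F|² ≤ |Φ μ| |(Φ μ)^#|` belongs to the representation space.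
Some `φ` interpolates `F` on the spectrum by Bessel's inequality, so `F = Φ φ + g q` with `q`
entire; the bound on the Cayley transform makes `q` constant, and its decay along the imaginary
axis makes `q` zero. -/
theorem mem_repSpace_of_norm_sq_le [CompleteSpace H] {A T : H →ₗ.[ℂ] H} {g : ℂ → ℂ} {z₀ : ℂ}
    {ψ₀ : H} (hA : MemSymR11 A) (hT : IsSelfAdjointExtension A T)
    (hg : IsRealEntire g) (hg_zero : ∀ z, g z = 0 ↔ z ∉ resolventSet T)
    (hg_simple : ∀ z, g z = 0 → deriv g z ≠ 0) (hz₀ : z₀ ∈ resolventSet T)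
    (hψ₀ : ψ₀ ∈ kerShift A† z₀) (hψ₀_ne : ψ₀ ≠ 0) {μ : H} {F : ℂ → ℂ} (hF : Differentiable ℂ F)
    (hFμ : ∀ z, ‖F z‖ ^ 2 ≤
      ‖repMap (xi T g z₀ ψ₀) μ z‖ * ‖repMap (xi T g z₀ ψ₀) μ (conj z)‖) :
    F ∈ repSpace T g z₀ ψ₀ := by
  obtain ⟨φ, hφ⟩ : ∃ φ : H, ∀ l : {l : ℂ // l ∉ resolventSet T},
      inner ℂ (xi T g z₀ ψ₀ l) φ = F l := by
    refine exists_inner_eq_of_norm_le (v := fun l : {l : ℂ // l ∉ resolventSet T} =>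
      xi T g z₀ ψ₀ l) (μ := μ) (fun l => ?_) (fun l m hlm => ?_) fun l => ?_
    · exact (xi_of_notMem_resolventSet hA hT hg.1 hg_zero hg_simple hz₀ hψ₀ hψ₀_ne l.2).1
    · exact inner_xi_eq_zero hA hT hg.1 hg_zero hg_simple hz₀ hψ₀ hψ₀_ne l.2 m.2
        fun h => hlm (Subtype.ext h)
    · have h := hFμ l
      change _ ≤ ‖inner ℂ (xi T g z₀ ψ₀ (conj (l : ℂ))) μ‖ *
        ‖inner ℂ (xi T g z₀ ψ₀ (conj (conj (l : ℂ)))) μ‖ at h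
      rw [conj_eq_of_notMem_resolventSet hT.2 l.2, conj_eq_of_notMem_resolventSet hT.2 l.2,
        ← sq] at h
      exact (sq_le_sq₀ (norm_nonneg _) (norm_nonneg _)).1 h
  have hΦ := differentiable_repMap_xi hA hT hg hg_zero hg_simple hz₀ hψ₀ hψ₀_ne φ
  obtain ⟨q, hq, hqeq⟩ := exists_differentiable_mul_eq (hF.sub hΦ) hg.1 hg_simple (by
    intro l hl
    have hl' := (hg_zero l).1 hl
    change F l - inner ℂ (xi T g z₀ ψ₀ (conj l)) φ = 0
    rw [conj_eq_of_notMem_resolventSet hT.2 hl', hφ ⟨l, hl'⟩, sub_self])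
  have hbound : ∀ z : ℂ, z.im ≠ 0 → ‖q z‖ ≤
      (‖μ‖ + ‖φ‖) * (‖cayley T z₀ ψ₀ z‖ + ‖cayley T z₀ ψ₀ (conj z)‖) := by
    intro z hz
    have hzρ := mem_resolventSet_of_im_ne_zero hT.2 hz
    have hgz : g z ≠ 0 := fun h => (hg_zero z).1 h hzρ
    have hgc : ‖g (conj z)‖ = ‖g z‖ := by
      rw [← hg.2 z, RCLike.norm_conj]
    have hF2 := hFμ z
    rw [repMap_xi_eq hT.2 hg.2 hzρ, repMap_xi_eq hT.2 hg.2 (conj_mem_resolventSet hT.2 hzρ),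
      Complex.conj_conj, norm_mul, norm_mul, hgc] at hF2
    set a := ‖cayley T z₀ ψ₀ z‖ with ha
    set b := ‖cayley T z₀ ψ₀ (conj z)‖ with hb
    have ha0 : 0 ≤ a := norm_nonneg _
    have hb0 : 0 ≤ b := norm_nonneg _
    have h1 : ‖inner ℂ (cayley T z₀ ψ₀ (conj z)) μ‖ ≤ b * ‖μ‖ := norm_inner_le_norm _ _
    have h2 : ‖inner ℂ (cayley T z₀ ψ₀ z) μ‖ ≤ a * ‖μ‖ := norm_inner_le_norm _ _
    have h3 : ‖inner ℂ (cayley T z₀ ψ₀ (conj z)) φ‖ ≤ b * ‖φ‖ := norm_inner_le_norm _ _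
    have hFz : ‖F z‖ ≤ ‖g z‖ * (‖μ‖ * (a + b)) := by
      refine (sq_le_sq₀ (norm_nonneg _) (by positivity)).1 (hF2.trans ?_)
      calc _ ≤ ‖g z‖ * (b * ‖μ‖) * (‖g z‖ * (a * ‖μ‖)) := by gcongr
        _ = (‖g z‖ * ‖μ‖) ^ 2 * (a * b) := by ring
        _ ≤ (‖g z‖ * ‖μ‖) ^ 2 * (a + b) ^ 2 := by gcongr; nlinarith
        _ = _ := by ring
    have hqz := hqeq z
    rw [Pi.sub_apply, repMap_xi_eq hT.2 hg.2 hzρ] at hqz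
    refine le_of_mul_le_mul_left ?_ (norm_pos_iff.2 hgz)
    calc ‖g z‖ * ‖q z‖ = ‖F z - g z * inner ℂ (cayley T z₀ ψ₀ (conj z)) φ‖ := by
          rw [hqz, norm_mul]
      _ ≤ ‖F z‖ + ‖g z‖ * ‖inner ℂ (cayley T z₀ ψ₀ (conj z)) φ‖ := by
          rw [← norm_mul]; exact norm_sub_le _ _
      _ ≤ ‖g z‖ * (‖μ‖ * (a + b)) + ‖g z‖ * (b * ‖φ‖) := by gcongr
      _ ≤ ‖g z‖ * (‖μ‖ * (a + b)) + ‖g z‖ * ((a + b) * ‖φ‖) := by gcongr; linarith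
      _ = _ := by ring
  have hconst := eq_const_of_abs_im_mul_norm_le hq
    (C := (‖μ‖ + ‖φ‖) * (2 * ((2 + ‖z₀‖) * ‖ψ₀‖))) (by
    intro z
    by_cases hz : z.im = 0
    · rw [hz, abs_zero, zero_mul]
      positivity
    · have h1 := abs_im_mul_norm_cayley_le hT.2 z₀ ψ₀ hz
      have h2 := abs_im_mul_norm_cayley_le hT.2 z₀ ψ₀ (z := conj z) (by simpa using hz)
      rw [Complex.conj_im, abs_neg, RCLike.norm_conj] at h2
      calc |z.im| * ‖q z‖ ≤ |z.im| * ((‖μ‖ + ‖φ‖) *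
            (‖cayley T z₀ ψ₀ z‖ + ‖cayley T z₀ ψ₀ (conj z)‖)) := by gcongr; exact hbound z hz
        _ = (‖μ‖ + ‖φ‖) * (|z.im| * ‖cayley T z₀ ψ₀ z‖ +
            |z.im| * ‖cayley T z₀ ψ₀ (conj z)‖) := by ring
        _ ≤ (‖μ‖ + ‖φ‖) * ((2 + ‖z₀‖) * ‖ψ₀‖ * (1 + ‖z‖) +
            (2 + ‖z₀‖) * ‖ψ₀‖ * (1 + ‖z‖)) := by gcongr
        _ = _ := by ring)
  have hq0 : q 0 = 0 := by
    have hlim := tendsto_cayley_mul_I hT.2 z₀ ψ₀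
    have hlim' : Filter.Tendsto (fun t : ℝ => cayley T z₀ ψ₀ (conj (t * Complex.I)))
        (Filter.cocompact ℝ) (𝓝 0) := by
      refine (hlim.comp (Homeomorph.neg ℝ).isClosedEmbedding.tendsto_cocompact).congr fun t => ?_
      simp
    have hsum := ((hlim.norm.add hlim'.norm).const_mul (‖μ‖ + ‖φ‖))
    rw [norm_zero, add_zero, mul_zero] at hsum
    have hev : ∀ᶠ t : ℝ in Filter.cocompact ℝ, ‖q 0‖ ≤ (‖μ‖ + ‖φ‖) *
        (‖cayley T z₀ ψ₀ (t * Complex.I)‖ + ‖cayley T z₀ ψ₀ (conj (t * Complex.I))‖) := by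
      have hne : ∀ᶠ t : ℝ in Filter.cocompact ℝ, t ≠ 0 :=
        (isCompact_singleton (x := (0 : ℝ))).compl_mem_cocompact
      filter_upwards [hne] with t ht
      rw [← hconst (t * Complex.I)]
      exact hbound _ (by simpa using ht)
    exact norm_le_zero_iff.1 (ge_of_tendsto hsum hev)
  refine ⟨φ, ?_⟩
  funext z
  have h := hqeq z
  rw [hconst z, hq0, mul_zero, Pi.sub_apply, sub_eq_zero] at h
  exact h.symm

end EntireOperators

end

theorem mainTheorem7 {H : Type*} [NormedAddCommGroup H] [InnerProductSpace ℂ H] [CompleteSpace H]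
    (A : H →ₗ.[ℂ] H) (hA : EntireOperators.MemSymR11 A)
    -- a selfadjoint extension of `A`
    (T : H →ₗ.[ℂ] H) (hT : EntireOperators.IsSelfAdjointExtension A T)
    -- a real entire function whose zeros are simple and form the spectrum of the extension
    (g : ℂ → ℂ) (hg : EntireOperators.IsRealEntire g)
    (hg_zero : {z : ℂ | g z = 0} = EntireOperators.spectrum T)
    (hg_simple : ∀ z : ℂ, g z = 0 → deriv g z ≠ 0)
    -- the starting point of the generalized Cayley transform
    (z₀ : ℂ) (hz₀ : z₀ ∉ EntireOperators.spectrum T)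
    (ψ₀ : H) (hψ₀ : ψ₀ ∈ EntireOperators.kerShift (LinearPMap.adjoint A) z₀) (hψ₀_ne : ψ₀ ≠ 0) :
    EntireOperators.IsEntireOperator A ↔
      ∃ f ∈ EntireOperators.repSpace T g z₀ ψ₀,
        EntireOperators.IsRealEntire f ∧ ∀ z : ℂ, f z ≠ 0 := by
  have hzero : ∀ z, g z = 0 ↔ z ∉ EntireOperators.resolventSet T := fun z =>
    Set.ext_iff.1 hg_zero z
  have hz₀' : z₀ ∈ EntireOperators.resolventSet T := not_not.1 hz₀
  have hdir : ∀ (μ : H) (z : ℂ), EntireOperators.DirectSumAt A μ z ↔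
      EntireOperators.repMap (EntireOperators.xi T g z₀ ψ₀) μ z ≠ 0 := by
    intro μ z
    have h := EntireOperators.xi_ne_zero_and_mem_ranShift_iff hA hT hg.1 hzero hg_simple hz₀'
      hψ₀ hψ₀_ne (conj z)
    rw [Complex.conj_conj] at h
    exact EntireOperators.directSumAt_iff h.1 h.2 μ
  constructor
  · rintro ⟨μ, -, hμ⟩
    have hμ' : ∀ z, EntireOperators.repMap (EntireOperators.xi T g z₀ ψ₀) μ z ≠ 0 := fun z =>
      (hdir μ z).1 (not_not.1 fun h => (Set.eq_empty_iff_forall_notMem.1 hμ z) h)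
    obtain ⟨F, hF, hF0, hFμ⟩ := EntireOperators.exists_isRealEntire_norm_sq_eq
      (EntireOperators.differentiable_repMap_xi hA hT hg hzero hg_simple hz₀' hψ₀ hψ₀_ne μ) hμ'
    exact ⟨F, EntireOperators.mem_repSpace_of_norm_sq_le hA hT hg hzero hg_simple hz₀' hψ₀
      hψ₀_ne hF.1 fun z => (hFμ z).le, hF, hF0⟩
  · rintro ⟨f, ⟨μ, rfl⟩, -, hf0⟩
    have h : ∀ z, EntireOperators.DirectSumAt A μ z := fun z => (hdir μ z).2 (hf0 z)
    exact ⟨μ, ⟨0, h 0⟩, Set.eq_empty_iff_forall_notMem.2 fun z hz => hz (h z)⟩
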